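/- Let $A$ be an $n\times n$ complex matrix and $c=(c_1,\dots,c_n)\in\mathbb{R}^n$. The $c$-numerical range of $A$ is $$W_c(A)=\Big\{\sum_{j=1}^n c_j\,x_j^*Ax_j \;:\; x_1,\dots,x_n\in\mathbb{C}^n \text{ orthonormal}\Big\}.$$ A point $\alpha\in W_c(A)$ is called a sharp point of $W_c(A)$ if there are real numbers $\theta_1<\theta_2$ such that for every $\theta\in(\theta_1,\theta_2)$ the line $\{z:\operatorname{Re}(e^{i\theta}z)=\operatorname{Re}(e^{i\theta}\alpha)\}$ supports $W_c(A)$, that is, $\operatorname{Re}(e^{i\theta}\alpha)=\max\{\operatorname{Re}(e^{i\theta}z):z\in W_c(A)\}$. Let $\lambda_1,\dots,\lambda_n$ be the eigenvalues of $A$, counted with algebraic multiplicity, and let $c_{i_1},\dots,c_{i_r}$ be the nonzero entries of $c$. A $c$-value of $A$ is a number of the form $c_{i_1}\lambda_{j_1}+\cdots+c_{i_r}\lambda_{j_r}$ with pairwise distinct indices $j_1,\dots,j_r\in\{1,\dots,n\}$. If $\alpha$ is a sharp point of $W_c(A)$, then $\alpha$ is a $c$-value of $A$. -/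

import Mathlib

open scoped Matrix

/-- The `c`-numerical range of an `n × n` complex matrix `A`, for a real `n`-tuple `c`: all sums
`∑ j, c j * (x j)^* A (x j)` over orthonormal `n`-tuples of vectors of `ℂⁿ`. -/
def cNumericalRange {n : ℕ} (c : Fin n → ℝ) (A : Matrix (Fin n) (Fin n) ℂ) : Set ℂ :=
  {z | ∃ x : Fin n → EuclideanSpace ℂ (Fin n), Orthonormal ℂ x ∧
    z = ∑ j, (c j : ℂ) * (star (x j).ofLp ⬝ᵥ A *ᵥ (x j).ofLp)}

/-- `α` is a sharp (corner) point of `S ⊆ ℂ`: it lies in `S`, and for every angle `θ` in some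
nondegenerate open interval the line `Re (e^{iθ} z) = Re (e^{iθ} α)` supports `S` at `α`, i.e.
`Re (e^{iθ} z) ≤ Re (e^{iθ} α)` for all `z ∈ S`. -/
def IsSharpPoint (S : Set ℂ) (α : ℂ) : Prop :=
  α ∈ S ∧ ∃ θ₁ θ₂ : ℝ, θ₁ < θ₂ ∧ ∀ θ ∈ Set.Ioo θ₁ θ₂,
    IsMaxOn (fun z : ℂ => (Complex.exp (θ * Complex.I) * z).re) S α

/-- `l` lists the `n` eigenvalues of `A`, each with its algebraic multiplicity. -/
def IsEigenvalueEnumeration {n : ℕ} (A : Matrix (Fin n) (Fin n) ℂ) (l : Fin n → ℂ) : Prop :=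
  A.charpoly.roots = Finset.univ.val.map l

/-- `z` is a `c`-value of `A`: with `l 0, …, l (n - 1)` the eigenvalues of `A` (with multiplicity),
`z` is the sum of `c i * l (j i)` over the indices `i` of the nonzero entries of `c`, for some
assignment `j` of pairwise distinct eigenvalue indices to those `i`. -/
def IsCValue {n : ℕ} (c : Fin n → ℝ) (A : Matrix (Fin n) (Fin n) ℂ) (z : ℂ) : Prop :=
  ∃ l : Fin n → ℂ, IsEigenvalueEnumeration A l ∧
    ∃ j : {i : Fin n // c i ≠ 0} ↪ Fin n, z = ∑ i : {i : Fin n // c i ≠ 0}, (c i : ℂ) * l (j i)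

/-! Write `α` using an orthonormal basis `x`. Rotating a pair `x i`, `x j` inside its span traces a
curve in the range through `α`. Its velocity has zero component in every supporting direction, and
two independent directions force it to vanish. Hence the matrix of `A` in the basis `x` has zero
`(i, j)` entry whenever `c i ≠ c j` (`formMatrix_eq_zero_of_isSharpPoint`). It is then block
diagonal along the level sets of `c`. Each block contributes its `c`-value times its trace, which is
the sum of its eigenvalues. -/

/-- The entries `(x i)^* A (x j)` of `A` with respect to the family `x`. -/
noncomputable def formMatrix {n : ℕ} (A : Matrix (Fin n) (Fin n) ℂ)
    (x : Fin n → EuclideanSpace ℂ (Fin n)) : Matrix (Fin n) (Fin n) ℂ :=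
  Matrix.of fun i j => star (x i).ofLp ⬝ᵥ A *ᵥ (x j).ofLp

/-- The family `x` with `x i`, `x j` replaced by `a x i + b x j`, `-b̄ x i + a x j`. -/
noncomputable def rotatePair {n : ℕ} (x : Fin n → EuclideanSpace ℂ (Fin n)) (i j : Fin n)
    (a : ℝ) (b : ℂ) : Fin n → EuclideanSpace ℂ (Fin n) := fun k =>
  if k = i then (a : ℂ) • x i + b • x j
  else if k = j then -(starRingEnd ℂ b) • x i + (a : ℂ) • x j
  else x k

theorem orthonormal_rotatePair {n : ℕ} {x : Fin n → EuclideanSpace ℂ (Fin n)}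
    (hx : Orthonormal ℂ x) {i j : Fin n} (hij : i ≠ j) {a : ℝ} {b : ℂ}
    (hab : (a : ℂ) * a + b * starRingEnd ℂ b = 1) : Orthonormal ℂ (rotatePair x i j a b) := by
  rw [orthonormal_iff_ite] at hx ⊢
  intro k l
  unfold rotatePair
  split_ifs <;> subst_vars <;>
    simp only [inner_add_left, inner_add_right, inner_smul_left, inner_smul_right, map_neg,
      Complex.conj_conj, Complex.conj_ofReal, *, if_true, if_false] <;> first | linear_combination hab | grind

theorem sum_rotatePair_sub {n : ℕ} (A : Matrix (Fin n) (Fin n) ℂ) (c : Fin n → ℝ)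
    (x : Fin n → EuclideanSpace ℂ (Fin n)) {i j : Fin n} (hij : i ≠ j) {a : ℝ} {b : ℂ}
    (hab : (a : ℂ) * a + b * starRingEnd ℂ b = 1) :
    ∑ k, (c k : ℂ) * formMatrix A (rotatePair x i j a b) k k
      = ∑ k, (c k : ℂ) * formMatrix A x k k
        + ((c i : ℂ) - c j) * (b * starRingEnd ℂ b * (formMatrix A x j j - formMatrix A x i i)
          + a * (b * formMatrix A x i j + starRingEnd ℂ b * formMatrix A x j i)) := by
  rw [← sub_eq_iff_eq_add', ← Finset.sum_sub_distrib, ← Finset.sum_subset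
    (Finset.subset_univ {i, j}), Finset.sum_pair hij]
  · simp only [formMatrix, rotatePair, Matrix.of_apply, if_pos, if_neg hij.symm, WithLp.ofLp_add,
      WithLp.ofLp_smul, star_add, star_smul, Matrix.mulVec_add, Matrix.mulVec_smul, add_dotProduct,
      dotProduct_add, smul_dotProduct, dotProduct_smul, smul_eq_mul, star_neg, RCLike.star_def,
      Complex.conj_conj, Complex.conj_ofReal]
    linear_combination
      ((c i : ℂ) * (star (x i).ofLp ⬝ᵥ A *ᵥ (x i).ofLp)
        + (c j : ℂ) * (star (x j).ofLp ⬝ᵥ A *ᵥ (x j).ofLp)) * hab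
  · intro k _ hk
    simp only [Finset.mem_insert, Finset.mem_singleton, not_or] at hk
    simp [formMatrix, rotatePair, hk.1, hk.2]

/-- First-order condition at the maximum `0` of a trigonometric polynomial. -/
theorem eq_zero_of_sin_sq_add_sin_mul_cos_nonpos {p q : ℝ}
    (h : ∀ t : ℝ, Real.sin t * Real.sin t * p + Real.cos t * Real.sin t * q ≤ 0) : q = 0 := by
  have hd : HasDerivAt
      (fun t : ℝ => Real.sin t * Real.sin t * p + Real.cos t * Real.sin t * q) q 0 := by
    have h1 := (((Real.hasDerivAt_sin 0).mul (Real.hasDerivAt_sin 0)).mul_const p).add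
      (((Real.hasDerivAt_cos 0).mul (Real.hasDerivAt_sin 0)).mul_const q)
    have hq : (Real.cos 0 * Real.sin 0 + Real.sin 0 * Real.cos 0) * p
        + (-Real.sin 0 * Real.sin 0 + Real.cos 0 * Real.cos 0) * q = q := by simp
    rwa [hq] at h1
  refine IsLocalMax.hasDerivAt_eq_zero (Filter.Eventually.of_forall fun t => ?_) hd
  simpa using h t

/-- Rotate with `a = cos t`, `b = w sin t`: the maximum is attained at `t = 0`, so the first-order
coefficient vanishes. -/
theorem re_exp_mul_eq_zero_of_isMaxOn {n : ℕ} {A : Matrix (Fin n) (Fin n) ℂ} {c : Fin n → ℝ}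
    {x : Fin n → EuclideanSpace ℂ (Fin n)} (hx : Orthonormal ℂ x) (e : ℂ)
    (hmax : IsMaxOn (fun z : ℂ => (e * z).re) (cNumericalRange c A)
      (∑ k, (c k : ℂ) * formMatrix A x k k)) {i j : Fin n} (hij : c i ≠ c j) {w : ℂ}
    (hw : w * starRingEnd ℂ w = 1) :
    (e * (w * formMatrix A x i j + starRingEnd ℂ w * formMatrix A x j i)).re = 0 := by
  have hne : i ≠ j := fun h => hij (h ▸ rfl)
  have key : (c i - c j) *
      (e * (w * formMatrix A x i j + starRingEnd ℂ w * formMatrix A x j i)).re = 0 := by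
    apply eq_zero_of_sin_sq_add_sin_mul_cos_nonpos
      (p := (c i - c j) * (e * (formMatrix A x j j - formMatrix A x i i)).re)
    intro t
    have hab : ((Real.cos t : ℝ) : ℂ) * (Real.cos t : ℝ)
        + ((Real.sin t : ℝ) * w) * starRingEnd ℂ ((Real.sin t : ℝ) * w) = 1 := by
      have h1 : ((Real.sin t : ℝ) : ℂ) ^ 2 + ((Real.cos t : ℝ) : ℂ) ^ 2 = 1 := by
        exact_mod_cast Real.sin_sq_add_cos_sq t
      rw [map_mul, Complex.conj_ofReal]
      linear_combination h1 + ((Real.sin t : ℝ) : ℂ) ^ 2 * hw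
    have hle := hmax (show _ ∈ cNumericalRange c A from
      ⟨_, orthonormal_rotatePair hx hne hab, rfl⟩)
    have hs := sum_rotatePair_sub A c x hne hab
    simp only [formMatrix, Matrix.of_apply] at hs
    simp only [Set.mem_ofPred_eq, formMatrix, Matrix.of_apply, hs] at hle
    rw [mul_add, Complex.add_re, add_le_iff_nonpos_right] at hle
    refine le_of_eq_of_le ?_ hle
    simp only [formMatrix, Matrix.of_apply]
    generalize star (x i).ofLp ⬝ᵥ A *ᵥ (x j).ofLp = p
    generalize star (x j).ofLp ⬝ᵥ A *ᵥ (x i).ofLp = q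
    generalize star (x j).ofLp ⬝ᵥ A *ᵥ (x j).ofLp - star (x i).ofLp ⬝ᵥ A *ᵥ (x i).ofLp = r
    have : e * (((c i : ℂ) - c j) * ((Real.sin t : ℝ) * w * starRingEnd ℂ ((Real.sin t : ℝ) * w) * r
          + (Real.cos t : ℝ) * ((Real.sin t : ℝ) * w * p
            + starRingEnd ℂ ((Real.sin t : ℝ) * w) * q)))
        = ((Real.sin t * Real.sin t * (c i - c j) : ℝ) : ℂ) * (e * r)
          + ((Real.cos t * Real.sin t * (c i - c j) : ℝ) : ℂ)
            * (e * (w * p + starRingEnd ℂ w * q)) := by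
      simp only [map_mul, Complex.conj_ofReal]
      push_cast
      linear_combination
        (e * ((c i : ℂ) - c j) * Complex.sin t * Complex.sin t * r) * hw
    rw [this, Complex.add_re, Complex.re_ofReal_mul, Complex.re_ofReal_mul]
    ring
  exact (mul_eq_zero.mp key).resolve_left (sub_ne_zero.mpr hij)

theorem eq_zero_of_re_exp_mul_eq_zero {θ₁ θ₂ : ℝ} (h : θ₁ < θ₂) {z : ℂ}
    (hz : ∀ θ ∈ Set.Ioo θ₁ θ₂, (Complex.exp (θ * Complex.I) * z).re = 0) : z = 0 := by
  obtain ⟨s, hs₁, hs₂⟩ := exists_between h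
  -- Keeping `t - s` below `π` makes the two real linear conditions on `z` independent, with
  -- determinant `sin (t - s)`.
  obtain ⟨t, ht₁, ht₂⟩ := exists_between (lt_min hs₂ (lt_add_of_pos_right s Real.pi_pos))
  have hsin : 0 < Real.sin (t - s) := by
    apply Real.sin_pos_of_pos_of_lt_pi
    · linarith
    · linarith [ht₂.trans_le (min_le_right _ _)]
  have h1 := hz s ⟨hs₁, hs₂⟩
  have h2 := hz t ⟨hs₁.trans ht₁, ht₂.trans_le (min_le_left _ _)⟩
  rw [Complex.mul_re, Complex.exp_ofReal_mul_I_re, Complex.exp_ofReal_mul_I_im] at h1 h2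
  rw [Real.sin_sub] at hsin
  apply Complex.ext
  · refine (mul_eq_zero.mp ?_).resolve_left hsin.ne'
    linear_combination Real.sin t * h1 - Real.sin s * h2
  · refine (mul_eq_zero.mp ?_).resolve_left hsin.ne'
    linear_combination Real.cos t * h1 - Real.cos s * h2

/-- The phases `w = 1` and `w = I` make both the sum and the difference of the `(i, j)` and `(j, i)`
entries vanish. -/
theorem formMatrix_eq_zero_of_isSharpPoint {n : ℕ} {A : Matrix (Fin n) (Fin n) ℂ} {c : Fin n → ℝ}
    {x : Fin n → EuclideanSpace ℂ (Fin n)} (hx : Orthonormal ℂ x)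
    (h : IsSharpPoint (cNumericalRange c A) (∑ k, (c k : ℂ) * formMatrix A x k k)) {i j : Fin n}
    (hij : c i ≠ c j) : formMatrix A x i j = 0 := by
  obtain ⟨-, θ₁, θ₂, hθ, hmax⟩ := h
  have h1 := eq_zero_of_re_exp_mul_eq_zero hθ fun θ hθ =>
    re_exp_mul_eq_zero_of_isMaxOn hx _ (hmax θ hθ) hij (w := 1) (by simp)
  have h2 := eq_zero_of_re_exp_mul_eq_zero hθ fun θ hθ =>
    re_exp_mul_eq_zero_of_isMaxOn hx _ (hmax θ hθ) hij (w := Complex.I) (by simp)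
  rw [map_one] at h1
  rw [Complex.conj_I] at h2
  linear_combination (1 / 2 : ℂ) * h1 - (Complex.I / 2) * h2
    + (1 / 2 : ℂ) * (formMatrix A x i j - formMatrix A x j i) * Complex.I_mul_I

theorem charpoly_formMatrix {n : ℕ} (A : Matrix (Fin n) (Fin n) ℂ)
    {x : Fin n → EuclideanSpace ℂ (Fin n)} (hx : Orthonormal ℂ x) :
    (formMatrix A x).charpoly = A.charpoly := by
  set X : Matrix (Fin n) (Fin n) ℂ := Matrix.of fun i j => x j i with hX
  have hXX : Xᴴ * X = 1 := by
    ext i j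
    rw [orthonormal_iff_ite] at hx
    rw [Matrix.one_apply, ← hx i j, EuclideanSpace.inner_eq_star_dotProduct, dotProduct_comm]
    rfl
  have hform : formMatrix A x = Xᴴ * (A * X) := by
    ext i j
    rfl
  rw [hform, Matrix.charpoly_mul_comm, Matrix.mul_assoc, mul_eq_one_comm.mp hXX, Matrix.mul_one]

theorem Multiset.exists_eq_map_univ {ι α : Type*} [Fintype ι] (s : Multiset α)
    (hs : s.card = Fintype.card ι) : ∃ l : ι → α, s = Finset.univ.val.map l := by
  obtain ⟨L, rfl⟩ := Quot.exists_rep s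
  have hL : L.length = Fintype.card ι := hs
  let e : ι ≃ Fin L.length := Fintype.equivFinOfCardEq hL.symm
  refine ⟨L.get ∘ e, ?_⟩
  rw [← Multiset.map_map]
  have he : (Finset.univ : Finset ι).val.map e = (Finset.univ : Finset (Fin L.length)).val := by
    exact congrArg Finset.val (Finset.map_univ_equiv e)
  rw [he, Fin.univ_val_map, List.ofFn_get]
  rfl

/-- Indexing the eigenvalues by `ι` itself lets the lists of the separate blocks be glued into one
list over `Fin n`. -/
theorem Matrix.exists_charpoly_eq_prod {ι : Type*} [Fintype ι] [DecidableEq ι]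
    (M : Matrix ι ι ℂ) :
    ∃ l : ι → ℂ, M.charpoly = ∏ i, (Polynomial.X - Polynomial.C (l i)) ∧ M.trace = ∑ i, l i := by
  have hsplit := IsAlgClosed.splits M.charpoly
  obtain ⟨l, hl⟩ := Multiset.exists_eq_map_univ (ι := ι) M.charpoly.roots
    (by rw [← hsplit.natDegree_eq_card_roots, M.charpoly_natDegree_eq_dim])
  refine ⟨l, ?_, ?_⟩
  · conv_lhs => rw [hsplit.eq_prod_roots_of_monic M.charpoly_monic, hl, Multiset.map_map]
    rfl
  · rw [Matrix.trace_eq_sum_roots_charpoly, hl]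
    rfl

/-- If `B` is block diagonal for the fibres of `c`, then `∑ c i * B i i` is the sum of the `c i`
times the eigenvalues of `B` in a suitable order. -/
theorem Matrix.exists_enumeration_of_blockDiagonal {n : ℕ} (B : Matrix (Fin n) (Fin n) ℂ)
    (c : Fin n → ℝ) (hB : ∀ i j, c i ≠ c j → B i j = 0) :
    ∃ l : Fin n → ℂ, IsEigenvalueEnumeration B l ∧
      ∑ i, (c i : ℂ) * B i i = ∑ i, (c i : ℂ) * l i := by
  choose L hL hT using fun a : ℝ => (B.toSquareBlock c a).exists_charpoly_eq_prod
  have hmaps : ∀ i ∈ (Finset.univ : Finset (Fin n)), c i ∈ Finset.univ.image c :=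
    fun i hi => Finset.mem_image_of_mem c hi
  refine ⟨fun i => L (c i) ⟨i, rfl⟩, ?_, ?_⟩
  · have hp : B.charpoly = ∏ i, (Polynomial.X - Polynomial.C (L (c i) ⟨i, rfl⟩)) := by
      have hblock : B.BlockTriangular c := fun i j h => hB i j h.ne'
      rw [hblock.charpoly, ← Finset.prod_fiberwise_of_maps_to hmaps]
      refine Finset.prod_congr rfl fun a _ => ?_
      rw [hL, Finset.prod_subtype (p := fun i => c i = a) _ (by simp)]
      refine Finset.prod_congr rfl ?_
      rintro ⟨i, rfl⟩ -
      rfl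
    rw [IsEigenvalueEnumeration, hp, Polynomial.roots_prod _ _
      (Finset.prod_ne_zero_iff.mpr fun i _ => Polynomial.X_sub_C_ne_zero _)]
    simp only [Polynomial.roots_X_sub_C, Multiset.bind_singleton]
  · rw [← Finset.sum_fiberwise_of_maps_to hmaps, ← Finset.sum_fiberwise_of_maps_to hmaps]
    refine Finset.sum_congr rfl fun a _ => ?_
    rw [Finset.sum_subtype (p := fun i => c i = a) _ (by simp),
      Finset.sum_subtype (p := fun i => c i = a) _ (by simp)]
    have hT' := congrArg ((a : ℂ) * ·) (hT a)
    simp only [Matrix.trace, Finset.mul_sum] at hT'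
    refine (Finset.sum_congr rfl ?_).trans (hT'.trans (Finset.sum_congr rfl ?_))
    · rintro ⟨i, rfl⟩ -
      rfl
    · rintro ⟨i, rfl⟩ -
      rfl

theorem mainTheorem8 {n : ℕ} (A : Matrix (Fin n) (Fin n) ℂ) (c : Fin n → ℝ) (α : ℂ)
    (hα : IsSharpPoint (cNumericalRange c A) α) :
    IsCValue c A α := by
  obtain ⟨x, hx, hαx⟩ := hα.1
  change α = ∑ k, (c k : ℂ) * formMatrix A x k k at hαx
  subst hαx
  obtain ⟨l, hl, hsum⟩ := (formMatrix A x).exists_enumeration_of_blockDiagonal c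
    fun i j hij => formMatrix_eq_zero_of_isSharpPoint hx hα hij
  -- `l` is already ordered so that `l i` is paired with `c i`; the assignment is the inclusion.
  refine ⟨l, ?_, Function.Embedding.subtype _, ?_⟩
  · rwa [IsEigenvalueEnumeration, charpoly_formMatrix A hx] at hl
  · rw [hsum]
    refine (Finset.sum_subset (Finset.subset_univ {i | c i ≠ 0}) fun i _ hi => ?_).symm.trans
      (Finset.sum_subtype (p := fun i => c i ≠ 0) _ (by simp) _)
    have hi0 : c i = 0 := by simpa using hi
    rw [hi0, Complex.ofReal_zero, zero_mul]
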